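/- Let $m\in\{0,1,2,\dots\}$, $\nu=m+\tfrac12$, $\alpha<1$, $b>0$, and put $\kappa=\frac1{1-\alpha}$, $z=\frac{(1-\alpha)b^2}{4}$, $d=\frac1{1-\alpha}$. Let $(a)_r=a(a+1)\cdots(a+r-1)$, $(a)_0=1$, let $\psi=\Gamma'/\Gamma$, let $1/\Gamma$ be $0$ at the poles of $\Gamma$, and let ${}_1F_2(a;b_1,b_2;x)=\sum_{r\ge0}\frac{(a)_r}{(b_1)_r(b_2)_r}\frac{x^r}{r!}$. Then the integrand below is integrable on $(0,d)$, the two infinite series below converge absolutely, and $$\int_0^d x^{\nu}[1-(1-\alpha)x]^{\frac1{1-\alpha}}e^{-bx^{-1/2}}\,dx=\frac{\Gamma(\kappa+1)}{\sqrt\pi\,(1-\alpha)^{\nu+1}}\Big\{\frac{\sqrt\pi\,\Gamma(m+\frac32)}{\Gamma(m+\frac52+\kappa)}\,{}_1F_2\big(-m-\tfrac32-\kappa;\tfrac12,-m-\tfrac12;z\big)$$ $$-\frac{2\sqrt\pi\,\Gamma(1+m)}{\Gamma(2+m+\kappa)}\,z^{1/2}\sum_{r=0}^{m}\frac1{r!}\frac{(-1-m-\kappa)_r}{(\frac32)_r(-m)_r}z^r+z^{m+\frac32}\sum_{r=0}^\infty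 z^r\,[-\ln z+G_r]H_r\Big\},$$ where $$G_r=\psi(-m-\tfrac32-r)-\psi(1+\kappa-r)+\psi(1+r)+\psi(2+m+r),$$ $$H_r=\frac{(-1)^{1+m+r}(-1)^r\,\Gamma(-m-\frac32-r)}{r!\,(1+m+r)!\,\Gamma(1+\kappa-r)}.$$ If $\kappa$ is a positive integer and $r>\kappa$, so that $1+\kappa-r=-n$ with $n\in\{0,1,2,\dots\}$ is a pole of $\psi$ and $H_r=0$, the product $[-\ln z+G_r]H_r$ is understood as its limit when the parameter $\kappa$ in $G_r$ and $H_r$ tends to its value with $z$ fixed; this limit exists and equals $\frac{(-1)^{1+m}(-1)^n\,n!\,\Gamma(-m-\frac32-r)}{r!\,(1+m+r)!}$. -/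

import Mathlib

open Filter Topology

noncomputable section

/-- The psi function `ψ(x) = Γ'(x) / Γ(x)` of a real variable. -/
def psi (x : ℝ) : ℝ := deriv Real.Gamma x / Real.Gamma x

/-- The Pochhammer symbol `(a)_r = a (a + 1) ⋯ (a + r - 1)`, with `(a)_0 = 1`. -/
def poch (a : ℝ) (r : ℕ) : ℝ := (ascPochhammer ℝ r).eval a

/-- The `r`-th term `(a)_r x ^ r / ((b)_r (c)_r r!)` of the hypergeometric series `₁F₂(a; b, c; x)`. -/
def oneFTwoTerm (a b c x : ℝ) (r : ℕ) : ℝ :=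
  poch a r / (poch b r * poch c r * (r.factorial : ℝ)) * x ^ r

/-- The generalized hypergeometric function `₁F₂(a; b, c; x)`
(for `b`, `c` not in `{0, -1, -2, …}`). -/
def oneFTwo (a b c x : ℝ) : ℝ := ∑' r : ℕ, oneFTwoTerm a b c x r

/-- The finite sum `∑_{r=0}^m (-1-m-κ)_r / ((3/2)_r (-m)_r r!) z ^ r`. -/
def finitePart (m : ℕ) (κ z : ℝ) : ℝ :=
  ∑ r ∈ Finset.range (m + 1),
    (1 / (r.factorial : ℝ)) * (poch (-1 - m - κ) r / (poch (3 / 2) r * poch (-m) r)) * z ^ r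

/-- `G_r = ψ(-m-3/2-r) - ψ(1+κ-r) + ψ(1+r) + ψ(2+m+r)`. -/
def coeffG (m : ℕ) (κ : ℝ) (r : ℕ) : ℝ :=
  psi (-m - 3 / 2 - r) - psi (1 + κ - r) + psi (1 + r) + psi (2 + m + r)

/-- `H_r = (-1)^{1+m+r} (-1)^r Γ(-m-3/2-r) / (r! (1+m+r)! Γ(1+κ-r))`;
Mathlib's `Γ` is `0` at its poles, so that `1/Γ` is `0` there, as usual. -/
def coeffH (m : ℕ) (κ : ℝ) (r : ℕ) : ℝ :=
  (-1) ^ (1 + m + r) * (-1) ^ r * Real.Gamma (-m - 3 / 2 - r) /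
    ((r.factorial : ℝ) * ((1 + m + r).factorial : ℝ) * Real.Gamma (1 + κ - r))

/-- The product `[-ln z + G_r] H_r`. -/
def logCoeff (m : ℕ) (κ z : ℝ) (r : ℕ) : ℝ :=
  (-Real.log z + coeffG m κ r) * coeffH m κ r

end

/-! The substitution u = (1-α)x reduces the integral to ∫₀¹ u^{m+1/2} (1-u)^κ e^{-X u^{-1/2}} du
with X = b√(1-α) = 2√z. Expand (1-u)^κ = ∑ c_j u^j; since κ > 0, ∑ |c_j| < ∞ and the sum leaves the
integral. With t = u^{-1/2} the j-th integral becomes 2 E_{N+1}(X), N = 2(m+j)+3, and classically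
(`expInt_eq`) E_{N+1}(X) = (-X)^N/N! (-ln X + ψ(N+1)) - ∑_{k≠N} (-X)^k / (k! (k-N)).

The double series over j and k converges absolutely. Summing over j first leaves ∑_j c_j/(j+a) with
a = (2m+3-k)/2, the partial fraction series of Γ(a)Γ(κ+1)/Γ(a+κ+1) (`betaSeries_eq`). Even k give
the ₁F₂, and odd k ≤ 2m+1 the finite sum. For k = 2(m+r)+3 one has a = -r, a pole: the omitted term
leaves the finite part there (`betaSeries_neg_nat`), which joins the logarithmic term with j = r.
The duplication-type identity `psi_neg_half` then gives the bracket -ln z + G_r.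

In that bracket ψ(1+κ-r)/Γ(1+κ-r) is minus the derivative of the entire function 1/Γ, so the
coefficient is continuous in κ (`logLimit`); this settles the poles of ψ. -/

/-! ### Reciprocal gamma function, psi and Pochhammer symbols. -/

/-- The entire function `1 / Γ`, restricted to the real line. -/
noncomputable def rGamma (x : ℝ) : ℝ := (Real.Gamma x)⁻¹

lemma contDiff_rGamma : ContDiff ℝ 1 rGamma := by
  have h : ContDiff ℂ 1 (fun s : ℂ => (Complex.Gamma s)⁻¹) :=
    Complex.differentiable_one_div_Gamma.contDiff
  have h2 : ContDiff ℝ 1 (fun x : ℝ => ((Complex.Gamma (x : ℂ))⁻¹)) :=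
    (h.restrict_scalars ℝ).comp Complex.ofRealCLM.contDiff
  have h3 : ContDiff ℝ 1 (fun x : ℝ => ((Complex.Gamma (x : ℂ))⁻¹).re) :=
    Complex.reCLM.contDiff.comp h2
  convert h3 using 1
  funext x
  rw [Complex.Gamma_ofReal, ← Complex.ofReal_inv, Complex.ofReal_re, rGamma]

lemma differentiable_rGamma : Differentiable ℝ rGamma := contDiff_rGamma.differentiable (by simp)

lemma continuous_deriv_rGamma : Continuous (deriv rGamma) := contDiff_rGamma.continuous_deriv le_rfl

lemma rGamma_eq_mul (x : ℝ) : rGamma x = x * rGamma (x + 1) := by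
  rcases eq_or_ne x 0 with rfl | hx
  · simp [rGamma]
  · rw [rGamma, rGamma, Real.Gamma_add_one hx, mul_inv, mul_inv_cancel_left₀ hx]

lemma deriv_rGamma_eq (x : ℝ) : deriv rGamma x = rGamma (x + 1) + x * deriv rGamma (x + 1) := by
  have h : rGamma = fun y => y * rGamma (y + 1) := funext rGamma_eq_mul
  have h1 : HasDerivAt (fun y => rGamma (y + 1)) (deriv rGamma (x + 1)) x :=
    (differentiable_rGamma (x + 1)).hasDerivAt.comp_add_const x 1
  have h2 := ((hasDerivAt_id x).mul h1).deriv
  conv_lhs => rw [h]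
  simpa using! h2

lemma rGamma_neg_nat (n : ℕ) : rGamma (-n) = 0 := by
  simp [rGamma, Real.Gamma_neg_nat_eq_zero]

/-- Differentiating 1/Γ(x) = x/Γ(x+1) at a zero gives a recursion for the slopes. This is the source
of the factor (-1)^n n! in the limiting coefficients. -/
lemma deriv_rGamma_neg_nat (n : ℕ) : deriv rGamma (-n) = (-1) ^ n * (n.factorial : ℝ) := by
  induction n with
  | zero =>
    rw [deriv_rGamma_eq]
    simp [rGamma]
  | succ n ih =>
    have h : -((n + 1 : ℕ) : ℝ) + 1 = -n := by push_cast; ring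
    rw [deriv_rGamma_eq, h, rGamma_neg_nat, ih, Nat.factorial_succ]
    push_cast
    ring

lemma rGamma_ne_zero {x : ℝ} (hx : ∀ n : ℕ, x ≠ -n) : rGamma x ≠ 0 :=
  inv_ne_zero (Real.Gamma_ne_zero hx)

lemma deriv_rGamma {x : ℝ} (hx : ∀ n : ℕ, x ≠ -n) : deriv rGamma x = -psi x * rGamma x := by
  have h := ((Real.differentiableAt_Gamma hx).hasDerivAt.inv (Real.Gamma_ne_zero hx)).deriv
  have h' : deriv rGamma x = -deriv Real.Gamma x / Real.Gamma x ^ 2 := by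
    rw [← h]; rfl
  rw [h', psi, rGamma]
  have := Real.Gamma_ne_zero hx
  field_simp

lemma psi_add_one {x : ℝ} (hx : ∀ n : ℕ, x ≠ -n) : psi (x + 1) = psi x + 1 / x := by
  have h0 : x ≠ 0 := by simpa using hx 0
  have hx1 : ∀ n : ℕ, x + 1 ≠ -n := fun n h => hx (n + 1) (by push_cast; linarith)
  have h1 := deriv_rGamma_eq x
  rw [deriv_rGamma hx, deriv_rGamma hx1, rGamma_eq_mul x] at h1
  have := rGamma_ne_zero hx1
  have h2 : rGamma (x + 1) * (-psi x * x) = rGamma (x + 1) * (1 - x * psi (x + 1)) := by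
    linear_combination h1
  have h3 := mul_left_cancel₀ this h2
  field_simp
  linear_combination h3

lemma half_ne_neg_nat (q n : ℕ) : (-q - 1 / 2 : ℝ) ≠ -n := by
  intro h
  have h' : ((2 * q + 1 : ℕ) : ℝ) = ((2 * n : ℕ) : ℝ) := by push_cast; linarith
  have := Nat.cast_injective h'
  omega

/-- Legendre duplication and reflection for `ψ`, at the points needed. -/
lemma psi_neg_half (q : ℕ) :
    psi (-q - 1 / 2) = 2 * psi (2 * q + 2) - 2 * Real.log 2 - psi (q + 1) := by
  induction q with
  | zero =>
    have h1 : psi 1 = -Real.eulerMascheroniConstant := by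
      simp [psi, Real.hasDerivAt_Gamma_one.deriv]
    have h2 : psi (1 / 2) = -(Real.eulerMascheroniConstant + 2 * Real.log 2) := by
      rw [psi, Real.hasDerivAt_Gamma_one_half.deriv, Real.Gamma_one_half_eq]
      have : √Real.pi ≠ 0 := by positivity
      field_simp
    have h3 := psi_add_one (x := -1 / 2) (fun n => by
      have := half_ne_neg_nat 0 n; norm_num at this ⊢; exact this)
    have h4 := psi_add_one (x := 1) (fun n => by
      have : (0 : ℝ) ≤ n := n.cast_nonneg
      linarith)
    norm_num at h2 h3 h4 ⊢
    rw [h1] at h4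
    rw [h2] at h3
    rw [h4, h1]
    linarith
  | succ q ih =>
    have hq : (0 : ℝ) ≤ q := q.cast_nonneg
    have h1 := psi_add_one (x := -((q + 1 : ℕ) : ℝ) - 1 / 2) (fun n => half_ne_neg_nat _ n)
    have h2 := psi_add_one (x := 2 * q + 2) (fun n => by
      have : (0 : ℝ) ≤ n := n.cast_nonneg
      linarith)
    have h3 := psi_add_one (x := 2 * q + 2 + 1) (fun n => by
      have : (0 : ℝ) ≤ n := n.cast_nonneg
      linarith)
    have h4 := psi_add_one (x := q + 1) (fun n => by
      have : (0 : ℝ) ≤ n := n.cast_nonneg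
      linarith)
    rw [show -((q + 1 : ℕ) : ℝ) - 1 / 2 + 1 = -q - 1 / 2 by push_cast; ring, ih] at h1
    push_cast at h1 ⊢
    rw [show (2 * ((q : ℝ) + 1) + 2) = 2 * q + 2 + 1 + 1 by ring, h3, h2, h4]
    have e : (1 : ℝ) / (-(q + 1) - 1 / 2) = -2 / (2 * q + 3) := by
      rw [div_eq_div_iff] <;> [ring; linarith; linarith]
    rw [e] at h1
    have e1 : (1 : ℝ) / (2 * q + 2) = 1 / (q + 1) / 2 := by field_simp
    have e2 : (1 : ℝ) / (2 * q + 2 + 1) = 1 / (2 * q + 3) := by ring_nf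
    have e3 : (-2 : ℝ) / (2 * q + 3) = -2 * (1 / (2 * q + 3)) := by ring
    rw [e1, e2]
    rw [e3] at h1
    linarith

lemma poch_zero (a : ℝ) : poch a 0 = 1 := by simp [poch]

lemma poch_succ (a : ℝ) (r : ℕ) : poch a (r + 1) = poch a r * (a + r) := by
  simp [poch, ascPochhammer_succ_eval]

lemma rGamma_sub_nat (x : ℝ) (p : ℕ) :
    rGamma (x - p) = (-1) ^ p * poch (1 - x) p * rGamma x := by
  induction p with
  | zero => simp [poch_zero]
  | succ p ih =>
    rw [rGamma_eq_mul, show x - ((p + 1 : ℕ) : ℝ) + 1 = x - p by push_cast; ring, ih, poch_succ]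
    push_cast
    ring

/-- No hypothesis on x is needed: the identity for 1/Γ is polynomial, and inverting it respects the
convention 0⁻¹ = 0. -/
lemma Gamma_sub_nat (x : ℝ) (p : ℕ) :
    Real.Gamma (x - p) = (-1) ^ p * Real.Gamma x / poch (1 - x) p := by
  have h := congrArg Inv.inv (rGamma_sub_nat x p)
  simp only [rGamma, inv_inv, mul_inv] at h
  rw [h, ← inv_pow]
  norm_num
  ring

/-! ### Series expansion of the exponential integral. -/

open MeasureTheory Set in
/-- The exponential integral `E_{N+1}(x) = ∫_1^∞ t^{-N-1} e^{-xt} dt`. -/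
noncomputable def expInt (N : ℕ) (x : ℝ) : ℝ :=
  ∫ t in Ioi (1 : ℝ), (t ^ (N + 1))⁻¹ * Real.exp (-(x * t))

lemma abs_inv_sub_nat_le_one (k N : ℕ) : |((k : ℝ) - N)⁻¹| ≤ 1 := by
  rcases eq_or_ne k N with rfl | h
  · simp
  · rw [abs_inv]
    apply inv_le_one_of_one_le₀
    have : (1 : ℤ) ≤ |(k : ℤ) - N| := Int.one_le_abs (by omega)
    exact_mod_cast this

/-- The term k = N is 0 because 0⁻¹ = 0, so this is the series with that index omitted. -/
lemma summable_expInt_series (N : ℕ) (x : ℝ) :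
    Summable (fun k : ℕ => (-x) ^ k / (k.factorial : ℝ) * ((k : ℝ) - N)⁻¹) := by
  refine Summable.of_norm_bounded (Real.summable_pow_div_factorial |x|) fun k => ?_
  rw [norm_mul, norm_div, norm_pow, norm_neg, Real.norm_natCast, Real.norm_eq_abs, Real.norm_eq_abs]
  exact mul_le_of_le_one_right (by positivity) (abs_inv_sub_nat_le_one k N)

open MeasureTheory Set in
lemma hasSum_integral_rpow_mul_exp {x s : ℝ} (hx : 0 < x) (hs : 0 < s) :
    HasSum (fun k : ℕ => (-x) ^ k / (k.factorial : ℝ) * ((k : ℝ) + s)⁻¹)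
      (∫ t in (0 : ℝ)..1, t ^ (s - 1) * Real.exp (-(x * t))) := by
  have hint : IntervalIntegrable (fun t : ℝ => t ^ (s - 1)) volume 0 1 :=
    intervalIntegral.intervalIntegrable_rpow' (by linarith)
  have h := intervalIntegral.hasSum_integral_of_dominated_convergence (a := 0) (b := 1)
    (μ := volume)
    (F := fun (k : ℕ) (t : ℝ) => (-x) ^ k / (k.factorial : ℝ) * (t ^ (s - 1) * t ^ k))
    (f := fun t => t ^ (s - 1) * Real.exp (-(x * t)))
    (fun k t => x ^ k / (k.factorial : ℝ) * t ^ (s - 1))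
    (fun k => by fun_prop)
    (fun k => by
      refine ae_of_all _ fun t ht => ?_
      rw [uIoc_of_le zero_le_one] at ht
      have h0 : 0 ≤ t ^ (s - 1) := Real.rpow_nonneg ht.1.le _
      have h1 : 0 ≤ t ^ k := pow_nonneg ht.1.le _
      rw [norm_mul, norm_div, norm_pow, norm_neg, Real.norm_natCast, Real.norm_of_nonneg hx.le,
        norm_mul, Real.norm_of_nonneg h0, Real.norm_of_nonneg h1]
      gcongr
      exact mul_le_of_le_one_right h0 (pow_le_one₀ ht.1.le ht.2))
    (ae_of_all _ fun t _ => (Real.summable_pow_div_factorial x).mul_right _)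
    (by
      simp_rw [tsum_mul_right]
      exact hint.const_mul _)
    (by
      refine ae_of_all _ fun t _ => ?_
      have h := (NormedSpace.expSeries_div_hasSum_exp (-(x * t))).mul_left (t ^ (s - 1))
      rw [← Real.exp_eq_exp_ℝ] at h
      convert! h using 1
      funext k
      rw [show -(x * t) = -x * t by ring, mul_pow]
      ring)
  convert! h using 1
  funext k
  rw [intervalIntegral.integral_const_mul]
  congr 1
  have : ∫ t in (0 : ℝ)..1, t ^ (s - 1) * t ^ k = ∫ t in (0 : ℝ)..1, t ^ (s - 1 + k) := by
    refine intervalIntegral.integral_congr_ae (ae_of_all _ fun t ht => ?_)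
    rw [uIoc_of_le zero_le_one] at ht
    rw [Real.rpow_add ht.1, Real.rpow_natCast]
  have hk : (0 : ℝ) ≤ k := k.cast_nonneg
  rw [this, integral_rpow (Or.inl (by linarith)), Real.one_rpow, Real.zero_rpow (by linarith)]
  rw [sub_zero, one_div]
  congr 1
  ring

open MeasureTheory Set in
lemma integral_Ioi_one_rpow_mul_exp {x s : ℝ} (hx : 0 < x) (hs : 0 < s) :
    ∫ t in Ioi (1 : ℝ), t ^ (s - 1) * Real.exp (-(x * t)) =
      x⁻¹ ^ s * Real.Gamma s - ∑' k : ℕ, (-x) ^ k / (k.factorial : ℝ) * ((k : ℝ) + s)⁻¹ := by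
  have h := Real.integral_rpow_mul_exp_neg_mul_Ioi hs hx
  have hi : IntegrableOn (fun t : ℝ => t ^ (s - 1) * Real.exp (-(x * t))) (Ioi 0) := by
    -- A non-integrable function would have integral 0, whereas the gamma integral is positive.
    by_contra hc
    rw [integral_undef hc] at h
    have : 0 < (1 / x) ^ s * Real.Gamma s := by have := Real.Gamma_pos_of_pos hs; positivity
    linarith
  have h2 := intervalIntegral.integral_interval_add_Ioi hi
    (hi.mono_set (Ioi_subset_Ioi (zero_le_one' ℝ)))
  rw [(hasSum_integral_rpow_mul_exp hx hs).tsum_eq, ← one_div, ← h, ← h2]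
  ring

open MeasureTheory Set in
lemma integrableOn_exp_neg_mul {x : ℝ} (hx : 0 < x) :
    IntegrableOn (fun t => Real.exp (-(x * t))) (Ioi 1) := by
  have := integrableOn_exp_mul_Ioi (a := -x) (by linarith) 1
  simpa using this

-- Regularise 1/t to t^{s-1} and let s → 0+. The pole 1/s of x^{-s} Γ(s) cancels the term k = 0 of
-- the series.
open MeasureTheory Set in
lemma expInt_zero {x : ℝ} (hx : 0 < x) :
    expInt 0 x = -Real.log x + psi 1 -
      ∑' k : ℕ, (-x) ^ k / (k.factorial : ℝ) * ((k : ℝ) - (0 : ℕ))⁻¹ := by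
  have hL : Tendsto (fun s : ℝ => ∫ t in Ioi (1 : ℝ), t ^ (s - 1) * Real.exp (-(x * t)))
      (𝓝[>] 0) (𝓝 (expInt 0 x)) := by
    refine tendsto_integral_filter_of_dominated_convergence (fun t => Real.exp (-(x * t)))
      (Eventually.of_forall fun s => by fun_prop) ?_ (integrableOn_exp_neg_mul hx) ?_
    · have h1 : ∀ᶠ s : ℝ in 𝓝[>] 0, s < 1 := nhdsWithin_le_nhds (eventually_lt_nhds one_pos)
      filter_upwards [h1] with s hs
      refine (ae_restrict_iff' measurableSet_Ioi).2 (ae_of_all _ fun t ht => ?_)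
      have ht : 1 < t := ht
      rw [norm_mul, Real.norm_of_nonneg (Real.exp_pos _).le,
        Real.norm_of_nonneg (Real.rpow_nonneg (by linarith) _)]
      exact mul_le_of_le_one_left (Real.exp_pos _).le
        (Real.rpow_le_one_of_one_le_of_nonpos ht.le (by linarith))
    · refine (ae_restrict_iff' measurableSet_Ioi).2 (ae_of_all _ fun t ht => ?_)
      have ht : 1 < t := ht
      refine Tendsto.mul_const _ (tendsto_nhdsWithin_of_tendsto_nhds ?_)
      have : ContinuousAt (fun s : ℝ => t ^ (s - 1)) 0 :=
        (Real.continuousAt_const_rpow (by linarith)).comp (by fun_prop)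
      convert this.tendsto using 2
      rw [zero_sub, Real.rpow_neg_one]
      simp
  have hR1 : Tendsto (fun s : ℝ => x⁻¹ ^ s * Real.Gamma s - s⁻¹) (𝓝[>] 0)
      (𝓝 (-Real.log x + psi 1)) := by
    have hG : HasDerivAt (fun s : ℝ => Real.Gamma (s + 1)) (psi 1) 0 := by
      have : HasDerivAt Real.Gamma (psi 1) (0 + 1) := by
        rw [zero_add, psi, Real.Gamma_one, div_one, Real.hasDerivAt_Gamma_one.deriv]
        exact Real.hasDerivAt_Gamma_one
      exact this.comp_add_const 0 1
    have hx' : HasDerivAt (fun s : ℝ => x⁻¹ ^ s) (-Real.log x) 0 := by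
      have := (hasDerivAt_id (0 : ℝ)).const_rpow (inv_pos.2 hx)
      simpa using this
    -- Since Γ(s) = Γ(s+1)/s, the regularised expression is the difference quotient of x^{-s} Γ(s+1)
    -- at 0.
    have h := (hx'.mul hG).tendsto_slope
    have h' := h.mono_left (nhdsWithin_mono 0 (fun s (hs : 0 < s) => hs.ne'))
    simp only [zero_add, Real.Gamma_one, mul_one, Real.rpow_zero, one_mul] at h'
    refine h'.congr' ?_
    filter_upwards [self_mem_nhdsWithin] with s hs
    have hs : 0 < s := hs
    simp only [slope, Pi.mul_apply, vsub_eq_sub, smul_eq_mul, sub_zero, zero_add, Real.Gamma_one,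
      Real.rpow_zero, Real.Gamma_add_one hs.ne', mul_one]
    field_simp
  have hR2 : Tendsto (fun s : ℝ => ∑' k : ℕ,
      (-x) ^ (k + 1) / ((k + 1).factorial : ℝ) * (((k + 1 : ℕ) : ℝ) + s)⁻¹) (𝓝[>] 0)
      (𝓝 (∑' k : ℕ, (-x) ^ (k + 1) / ((k + 1).factorial : ℝ) * (((k + 1 : ℕ) : ℝ))⁻¹)) := by
    refine tendsto_tsum_of_dominated_convergence
      ((summable_nat_add_iff 1).2 (Real.summable_pow_div_factorial x)) (fun k => ?_) ?_
    · refine Tendsto.const_mul _ (tendsto_nhdsWithin_of_tendsto_nhds ?_)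
      have : ContinuousAt (fun s : ℝ => (((k + 1 : ℕ) : ℝ) + s)⁻¹) 0 := by
        refine ContinuousAt.inv₀ (by fun_prop) ?_
        rw [add_zero]
        positivity
      simpa using this.tendsto
    · filter_upwards [self_mem_nhdsWithin] with s hs k
      have hs : 0 < s := hs
      rw [norm_mul, norm_div, norm_pow, norm_neg, Real.norm_natCast, Real.norm_of_nonneg hx.le]
      refine mul_le_of_le_one_right (by positivity) ?_
      rw [Real.norm_of_nonneg (by positivity)]
      apply inv_le_one_of_one_le₀
      push_cast
      have : (0 : ℝ) ≤ k := k.cast_nonneg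
      linarith
  refine tendsto_nhds_unique hL ?_
  have e : ∑' k : ℕ, (-x) ^ k / (k.factorial : ℝ) * ((k : ℝ) - (0 : ℕ))⁻¹ =
      ∑' k : ℕ, (-x) ^ (k + 1) / ((k + 1).factorial : ℝ) * (((k + 1 : ℕ) : ℝ))⁻¹ := by
    rw [(summable_expInt_series 0 x).tsum_eq_zero_add]
    simp
  rw [e]
  refine (hR1.sub hR2).congr' ?_
  filter_upwards [self_mem_nhdsWithin] with s hs
  have hs : 0 < s := hs
  rw [integral_Ioi_one_rpow_mul_exp hx hs, (hasSum_integral_rpow_mul_exp hx hs).summable.tsum_eq_zero_add]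
  simp
  ring

open MeasureTheory Set in
lemma integrableOn_expInt {x : ℝ} (hx : 0 < x) (N : ℕ) :
    IntegrableOn (fun t => (t ^ (N + 1))⁻¹ * Real.exp (-(x * t))) (Ioi 1) := by
  refine Integrable.mono' (integrableOn_exp_neg_mul hx)
    (Measurable.aestronglyMeasurable (by fun_prop)) ?_
  refine (ae_restrict_iff' measurableSet_Ioi).2 (ae_of_all _ fun t ht => ?_)
  have ht : 1 < t := ht
  have h0 : 1 ≤ t ^ (N + 1) := one_le_pow₀ ht.le
  rw [norm_mul, Real.norm_of_nonneg (Real.exp_pos _).le, norm_inv, Real.norm_of_nonneg (by linarith)]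
  exact mul_le_of_le_one_left (Real.exp_pos _).le (inv_le_one_of_one_le₀ h0)

-- Integration by parts: t^{-N-1} e^{-xt} vanishes at infinity and equals e^{-x} at t = 1.
open MeasureTheory Set in
lemma expInt_succ {x : ℝ} (hx : 0 < x) (N : ℕ) :
    (N + 1) * expInt (N + 1) x = Real.exp (-x) - x * expInt N x := by
  have hderiv : ∀ t ∈ Ici (1 : ℝ), HasDerivAt (fun t : ℝ => -((t ^ (N + 1))⁻¹ * Real.exp (-(x * t))))
      ((N + 1) * ((t ^ (N + 1 + 1))⁻¹ * Real.exp (-(x * t))) +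
        x * ((t ^ (N + 1))⁻¹ * Real.exp (-(x * t)))) t := by
    intro t ht
    have ht : 1 ≤ t := ht
    have ht0 : t ≠ 0 := by linarith
    have h1 : HasDerivAt (fun t : ℝ => (t ^ (N + 1))⁻¹) _ t :=
      (hasDerivAt_pow (N + 1) t).inv (pow_ne_zero _ ht0)
    have h2 : HasDerivAt (fun t : ℝ => Real.exp (-(x * t))) (Real.exp (-(x * t)) * -(x * 1)) t :=
      (((hasDerivAt_id t).const_mul x).neg).exp
    refine (h1.mul h2).neg.congr_deriv ?_
    simp only [mul_one, Nat.add_sub_cancel, Nat.cast_add, Nat.cast_one]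
    field_simp
    ring
  have i1 := (integrableOn_expInt hx (N + 1)).const_mul ((N : ℝ) + 1)
  have i2 := (integrableOn_expInt hx N).const_mul x
  have hlim : Tendsto (fun t : ℝ => -((t ^ (N + 1))⁻¹ * Real.exp (-(x * t)))) atTop (𝓝 0) := by
    have h1 : Tendsto (fun t : ℝ => (t ^ (N + 1))⁻¹) atTop (𝓝 0) :=
      (tendsto_pow_atTop (by omega)).inv_tendsto_atTop
    have h2 : Tendsto (fun t : ℝ => Real.exp (-(x * t))) atTop (𝓝 0) :=
      Real.tendsto_exp_neg_atTop_nhds_zero.comp (tendsto_id.const_mul_atTop hx)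
    simpa using (h1.mul h2).neg
  have h := integral_Ioi_of_hasDerivAt_of_tendsto' hderiv (i1.add i2) hlim
  rw [integral_add i1 i2, integral_const_mul, integral_const_mul] at h
  rw [expInt, expInt]
  simp only [one_pow, inv_one, one_mul, mul_one, sub_neg_eq_add, zero_add] at h
  linarith

lemma expInt_eq {x : ℝ} (hx : 0 < x) (N : ℕ) :
    expInt N x = (-x) ^ N / (N.factorial : ℝ) * (-Real.log x + psi (N + 1)) -
      ∑' k : ℕ, (-x) ^ k / (k.factorial : ℝ) * ((k : ℝ) - N)⁻¹ := by
  induction N with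
  | zero => simpa using expInt_zero hx
  | succ N ih =>
    have hN : (0 : ℝ) ≤ N := N.cast_nonneg
    have hexp : HasSum (fun k : ℕ => (-x) ^ k / (k.factorial : ℝ)) (Real.exp (-x)) := by
      rw [Real.exp_eq_exp_ℝ]
      exact NormedSpace.expSeries_div_hasSum_exp (-x)
    have hs := (summable_expInt_series N x).hasSum.mul_left x
    have hs' : HasSum (fun j : ℕ => (-x) ^ j / (j.factorial : ℝ) * (j * ((j : ℝ) - (N + 1 : ℕ))⁻¹))
        (-(x * ∑' k : ℕ, (-x) ^ k / (k.factorial : ℝ) * ((k : ℝ) - N)⁻¹)) := by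
      rw [← hasSum_nat_add_iff' 1]
      simp only [Finset.range_one, Finset.sum_singleton, Nat.cast_zero, zero_mul, mul_zero, sub_zero]
      convert! hs.neg using 1
      funext k
      rw [Nat.factorial_succ]
      push_cast
      rw [show (k : ℝ) + 1 - (N + 1) = k - N by ring]
      field_simp
      ring
    -- For k ≠ N+1, 1 - k/(k-N-1) = -(N+1)/(k-N-1). At k = N+1 the inverse is 0 and a whole
    -- exponential term survives; `hd` removes it, and it feeds the step from ψ(N+1) to ψ(N+2).
    have hd := (hasSum_ite_eq (N + 1) ((-x) ^ (N + 1) / ((N + 1).factorial : ℝ)))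
    have hall := ((hexp.sub hs').sub hd).div_const (-((N : ℝ) + 1))
    have key : (fun b : ℕ => ((-x) ^ b / (b.factorial : ℝ) -
          (-x) ^ b / (b.factorial : ℝ) * (b * ((b : ℝ) - (N + 1 : ℕ))⁻¹) -
          if b = N + 1 then (-x) ^ (N + 1) / ((N + 1).factorial : ℝ) else 0) / -((N : ℝ) + 1)) =
        fun k : ℕ => (-x) ^ k / (k.factorial : ℝ) * ((k : ℝ) - (N + 1 : ℕ))⁻¹ := by
      funext k
      split_ifs with hk
      · subst hk
        simp
      · have : (k : ℝ) - (N + 1 : ℕ) ≠ 0 := by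
          rw [sub_ne_zero]
          exact_mod_cast hk
        have h1 : -((N : ℝ) + 1) ≠ 0 := by linarith
        push_cast at this ⊢
        field_simp
        ring
    rw [key] at hall
    rw [hall.tsum_eq]
    have hrec := expInt_succ hx N
    have hpsi := psi_add_one (x := N + 1) (fun n => by
      have : (0 : ℝ) ≤ n := n.cast_nonneg
      linarith)
    rw [ih] at hrec
    have h1 : (N : ℝ) + 1 ≠ 0 := by linarith
    have : expInt (N + 1) x = ((N + 1) * expInt (N + 1) x) / (N + 1) := by field_simp
    rw [this, hrec]
    push_cast
    rw [hpsi, Nat.factorial_succ]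
    push_cast
    field_simp
    ring

/-! ### Binomial coefficients and the partial fraction series of the beta function. -/

/-- The coefficient of `u ^ j` in the binomial series of `(1 - u) ^ κ`. -/
noncomputable def binomCoeff (κ : ℝ) (j : ℕ) : ℝ := poch (-κ) j / (j.factorial : ℝ)

lemma binomCoeff_succ (κ : ℝ) (j : ℕ) :
    binomCoeff κ (j + 1) * (j + 1) = binomCoeff κ j * (j - κ) := by
  rw [binomCoeff, binomCoeff, poch_succ, Nat.factorial_succ]
  push_cast
  have : (j : ℝ) + 1 ≠ 0 := by positivity
  field_simp
  ring

lemma binomCoeff_eq_choose (κ : ℝ) (j : ℕ) : binomCoeff κ j = (-1) ^ j * Ring.choose κ j := by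
  have h : ((-1) ^ j * (-1) ^ j : ℝ) = 1 := by rw [← mul_pow]; simp
  have h2 := Polynomial.ascPochhammer_smeval_neg_eq_descPochhammer κ j
  rw [Polynomial.ascPochhammer_smeval_eq_eval, Int.negOnePow_def, Units.smul_def] at h2
  rw [Ring.choose_eq_smul, binomCoeff, poch, h2]
  simp [div_eq_inv_mul]
  ring

lemma hasSum_binomCoeff {u : ℝ} (κ : ℝ) (h0 : 0 ≤ u) (h1 : u < 1) :
    HasSum (fun j => binomCoeff κ j * u ^ j) ((1 - u) ^ κ) := by
  have hu : -u ∈ Metric.eball (0 : ℝ) 1 := by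
    simp [← ENNReal.ofReal_one, abs_of_nonneg h0, h1]
  have h := (Real.one_add_rpow_hasFPowerSeriesOnBall_zero (a := κ)).hasSum hu
  simp only [zero_add, binomialSeries_apply] at h
  convert! h using 1
  funext j
  simp [binomCoeff_eq_choose, neg_pow u]
  ring

/-- For j > κ the ratio of consecutive coefficients is positive, and κ|c_j| = j|c_j| -
(j+1)|c_{j+1}| telescopes. -/
lemma summable_abs_binomCoeff {κ : ℝ} (hκ : 0 < κ) : Summable fun j => |binomCoeff κ j| := by
  obtain ⟨J, hJ⟩ := exists_nat_gt κ
  rw [← summable_nat_add_iff J]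
  have hstep : ∀ j : ℕ, κ * |binomCoeff κ (j + J)| =
      ((j + J : ℕ) : ℝ) * |binomCoeff κ (j + J)| -
        ((j + 1 + J : ℕ) : ℝ) * |binomCoeff κ (j + 1 + J)| := by
    intro j
    have h := congrArg abs (binomCoeff_succ κ (j + J))
    have hj : (0 : ℝ) ≤ j := j.cast_nonneg
    have hpos : (0 : ℝ) ≤ ((j + J : ℕ) : ℝ) - κ := by push_cast; linarith
    rw [abs_mul, abs_mul, abs_of_nonneg hpos,
      abs_of_nonneg (by positivity : (0 : ℝ) ≤ ((j + J : ℕ) : ℝ) + 1),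
      show j + J + 1 = j + 1 + J by ring] at h
    push_cast at h ⊢
    linarith
  have hsum : ∀ n : ℕ, ∑ j ∈ Finset.range n, |binomCoeff κ (j + J)| ≤
      (J : ℝ) * |binomCoeff κ J| / κ := by
    intro n
    rw [le_div_iff₀ hκ, mul_comm, Finset.mul_sum, Finset.sum_congr rfl fun j _ => hstep j,
      Finset.sum_range_sub' (fun j : ℕ => ((j + J : ℕ) : ℝ) * |binomCoeff κ (j + J)|)]
    have : 0 ≤ ((n + J : ℕ) : ℝ) * |binomCoeff κ (n + J)| := by positivity
    simpa using this
  exact summable_of_sum_range_le (fun _ => abs_nonneg _) hsum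

/-- The partial-fraction series `∑ c_j / (j + a)`, a beta function;
the term `j = -a`, if there is one, is left out. -/
noncomputable def betaSeries (κ a : ℝ) : ℝ := ∑' j : ℕ, binomCoeff κ j * ((j : ℝ) + a)⁻¹

lemma exists_abs_inv_add_le (a : ℝ) : ∃ C : ℝ, ∀ j : ℕ, |((j : ℝ) + a)⁻¹| ≤ C := by
  have h : Tendsto (fun j : ℕ => |((j : ℝ) + a)⁻¹|) atTop (𝓝 |0|) :=
    ((tendsto_natCast_atTop_atTop.atTop_add tendsto_const_nhds).inv_tendsto_atTop).abs
  obtain ⟨C, hC⟩ := h.bddAbove_range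
  exact ⟨C, fun j => hC ⟨j, rfl⟩⟩

lemma summable_betaSeries {κ : ℝ} (hκ : 0 < κ) (a : ℝ) :
    Summable fun j : ℕ => binomCoeff κ j * ((j : ℝ) + a)⁻¹ := by
  obtain ⟨C, hC⟩ := exists_abs_inv_add_le a
  refine Summable.of_norm_bounded ((summable_abs_binomCoeff hκ).mul_right C) fun j => ?_
  rw [norm_mul]
  exact mul_le_mul_of_nonneg_left (hC j) (abs_nonneg _)

lemma betaSeries_add_one {κ : ℝ} (hκ : 0 < κ) {a : ℝ} (ha : ∀ n : ℕ, a ≠ -n) :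
    a * betaSeries κ a = (a + κ + 1) * betaSeries κ (a + 1) := by
  have hne : ∀ j : ℕ, (j : ℝ) + a ≠ 0 := fun j h => ha j (by linarith)
  have hc : Summable (binomCoeff κ) := (summable_abs_binomCoeff hκ).of_abs
  have h1 := (summable_betaSeries hκ a).hasSum.mul_left a
  have h2 := (summable_betaSeries hκ (a + 1)).hasSum.mul_left (a + κ + 1)
  have h3 : HasSum (fun j : ℕ => binomCoeff κ j - a * (binomCoeff κ j * ((j : ℝ) + a)⁻¹))
      (∑' j, binomCoeff κ j - a * betaSeries κ a) := hc.hasSum.sub h1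
  have h4 : HasSum (fun j : ℕ => binomCoeff κ j -
      (a + κ + 1) * (binomCoeff κ j * ((j : ℝ) + (a + 1))⁻¹))
      (∑' j, binomCoeff κ j - (a + κ + 1) * betaSeries κ (a + 1)) := hc.hasSum.sub h2
  -- The first series has zero initial term; after a shift by one, the coefficient recursion makes
  -- it equal to the second term by term.
  rw [← hasSum_nat_add_iff' 1] at h3
  have h0 : binomCoeff κ 0 - a * (binomCoeff κ 0 * (((0 : ℕ) : ℝ) + a)⁻¹) = 0 := by
    have := hne 0
    simp only [Nat.cast_zero, zero_add] at this ⊢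
    field_simp
    ring
  simp only [Finset.range_one, Finset.sum_singleton, h0, sub_zero] at h3
  have e : (fun j : ℕ => binomCoeff κ (j + 1) -
      a * (binomCoeff κ (j + 1) * (((j + 1 : ℕ) : ℝ) + a)⁻¹)) = fun j : ℕ => binomCoeff κ j -
      (a + κ + 1) * (binomCoeff κ j * ((j : ℝ) + (a + 1))⁻¹) := by
    funext j
    have h5 := binomCoeff_succ κ j
    have h6 := hne (j + 1)
    have h7 : (j : ℝ) + (a + 1) ≠ 0 := by push_cast at h6; intro h; exact h6 (by linarith)
    push_cast at h6 ⊢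
    rw [show (j : ℝ) + 1 + a = j + (a + 1) by ring]
    field_simp
    linear_combination h5
  rw [e] at h3
  linarith [h3.unique h4]

open MeasureTheory Set in
lemma betaSeries_of_pos {κ : ℝ} (hκ : 0 < κ) {a : ℝ} (ha : 0 < a) :
    betaSeries κ a = Real.Gamma a * Real.Gamma (κ + 1) * rGamma (a + κ + 1) := by
  have hint : IntervalIntegrable (fun t : ℝ => t ^ (a - 1)) volume 0 1 :=
    intervalIntegral.intervalIntegrable_rpow' (by linarith)
  have h := intervalIntegral.hasSum_integral_of_dominated_convergence (a := 0) (b := 1)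
    (μ := volume)
    (F := fun (k : ℕ) (t : ℝ) => binomCoeff κ k * (t ^ (a - 1) * t ^ k))
    (f := fun t => t ^ (a - 1) * (1 - t) ^ κ)
    (fun k t => |binomCoeff κ k| * t ^ (a - 1))
    (fun k => by fun_prop)
    (fun k => by
      refine ae_of_all _ fun t ht => ?_
      rw [uIoc_of_le zero_le_one] at ht
      have h0 : 0 ≤ t ^ (a - 1) := Real.rpow_nonneg ht.1.le _
      have h1 : 0 ≤ t ^ k := pow_nonneg ht.1.le _
      rw [norm_mul, norm_mul, Real.norm_of_nonneg h0, Real.norm_of_nonneg h1, Real.norm_eq_abs]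
      gcongr
      exact mul_le_of_le_one_right h0 (pow_le_one₀ ht.1.le ht.2))
    (ae_of_all _ fun t _ => (summable_abs_binomCoeff hκ).mul_right _)
    (by
      simp_rw [tsum_mul_right]
      exact hint.const_mul _)
    (by
      filter_upwards [Measure.ae_ne volume (1 : ℝ)] with t ht1 ht
      rw [uIoc_of_le zero_le_one] at ht
      have h := (hasSum_binomCoeff κ ht.1.le (lt_of_le_of_ne ht.2 ht1)).mul_left (t ^ (a - 1))
      convert! h using 1
      funext k
      ring)
  have e : (fun k : ℕ => ∫ t in (0 : ℝ)..1, binomCoeff κ k * (t ^ (a - 1) * t ^ k)) =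
      fun k : ℕ => binomCoeff κ k * ((k : ℝ) + a)⁻¹ := by
    funext k
    rw [intervalIntegral.integral_const_mul]
    congr 1
    have : ∫ t in (0 : ℝ)..1, t ^ (a - 1) * t ^ k = ∫ t in (0 : ℝ)..1, t ^ (a - 1 + k) := by
      refine intervalIntegral.integral_congr_ae (ae_of_all _ fun t ht => ?_)
      rw [uIoc_of_le zero_le_one] at ht
      rw [Real.rpow_add ht.1, Real.rpow_natCast]
    have hk : (0 : ℝ) ≤ k := k.cast_nonneg
    rw [this, integral_rpow (Or.inl (by linarith)), Real.one_rpow, Real.zero_rpow (by linarith)]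
    rw [sub_zero, one_div]
    congr 1
    ring
  rw [e] at h
  rw [betaSeries, h.tsum_eq, rGamma, ← div_eq_mul_inv, add_assoc]
  have hb := ProbabilityTheory.beta_eq_betaIntegralReal a (κ + 1) ha (by linarith)
  have hb' : Real.Gamma a * Real.Gamma (κ + 1) / Real.Gamma (a + (κ + 1)) =
    (Complex.betaIntegral a (κ + 1 : ℝ)).re := hb
  rw [hb', Complex.betaIntegral]
  have : ∫ x in (0 : ℝ)..1, (x : ℂ) ^ ((a : ℂ) - 1) * (1 - (x : ℂ)) ^ (((κ + 1 : ℝ) : ℂ) - 1) =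
      ((∫ x in (0 : ℝ)..1, x ^ (a - 1) * (1 - x) ^ κ : ℝ) : ℂ) := by
    rw [← intervalIntegral.integral_ofReal]
    refine intervalIntegral.integral_congr_ae (ae_of_all _ fun t ht => ?_)
    rw [uIoc_of_le zero_le_one] at ht
    rw [Complex.ofReal_mul, Complex.ofReal_cpow ht.1.le, Complex.ofReal_cpow (by linarith [ht.2])]
    push_cast
    simp
  rw [this, Complex.ofReal_re]

/-- Both sides satisfy the same recursion in a, which continues the case a > 0 leftwards past the
poles. -/
lemma betaSeries_eq {κ : ℝ} (hκ : 0 < κ) {a : ℝ} (ha : ∀ n : ℕ, a ≠ -n) :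
    betaSeries κ a = Real.Gamma a * Real.Gamma (κ + 1) * rGamma (a + κ + 1) := by
  obtain ⟨N, hN⟩ := exists_nat_gt (-a)
  induction N generalizing a with
  | zero => exact betaSeries_of_pos hκ (by simpa using hN)
  | succ N ih =>
    have h0 : a ≠ 0 := by simpa using ha 0
    have h := ih (a := a + 1) (fun n h => ha (n + 1) (by push_cast; linarith))
      (by push_cast at hN; linarith)
    apply mul_left_cancel₀ h0
    rw [betaSeries_add_one hκ ha, h, Real.Gamma_add_one h0, rGamma_eq_mul (a + κ + 1)]
    rw [show a + κ + 1 + 1 = a + 1 + κ + 1 by ring]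
    ring

lemma binomCoeff_eq_rGamma {κ : ℝ} (hκ : 0 < κ) (r : ℕ) :
    binomCoeff κ r = (-1) ^ r / (r.factorial : ℝ) * Real.Gamma (κ + 1) * rGamma (κ + 1 - r) := by
  rw [rGamma_sub_nat, binomCoeff, rGamma, show 1 - (κ + 1) = -κ by ring]
  have := (Real.Gamma_pos_of_pos (by linarith : 0 < κ + 1)).ne'
  field_simp
  rw [← pow_mul, mul_comm r, pow_mul]
  simp

/-- Isolates the simple pole of Γ at -r: the right side is smooth near e = 0. -/
lemma self_mul_Gamma_sub_nat {e : ℝ} (he : 0 < |e|) (he1 : |e| < 1) (r : ℕ) :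
    e * Real.Gamma (e - r) =
      (-1) ^ r * (Real.Gamma (1 + e) * Real.Gamma (1 - e)) * rGamma (1 + r - e) := by
  have h0 := abs_pos.1 he
  have h1 := abs_lt.1 he1
  induction r with
  | zero =>
    have := (Real.Gamma_pos_of_pos (by linarith : 0 < 1 - e)).ne'
    simp only [Nat.cast_zero, sub_zero, add_zero, pow_zero, one_mul, rGamma]
    rw [mul_inv_cancel_right₀ this, add_comm, Real.Gamma_add_one h0]
  | succ r ih =>
    have hr : (0 : ℝ) ≤ r := r.cast_nonneg
    have hne : e - ((r + 1 : ℕ) : ℝ) ≠ 0 := by push_cast; linarith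
    apply mul_left_cancel₀ hne
    have h2 := Real.Gamma_add_one hne
    rw [show e - ((r + 1 : ℕ) : ℝ) + 1 = e - r by push_cast; ring] at h2
    rw [mul_left_comm, ← h2, ih, rGamma_eq_mul (1 + r - e)]
    push_cast
    rw [show 1 + (r : ℝ) - e + 1 = 1 + (r + 1) - e by ring]
    ring

/-- At a = e - r the index j = r contributes exactly c_r/e; the other terms pass to the limit by
domination. -/
lemma tendsto_betaSeries_punctured {κ : ℝ} (hκ : 0 < κ) (r : ℕ) :
    Tendsto (fun e : ℝ => betaSeries κ (e - r) - binomCoeff κ r / e) (𝓝[≠] 0)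
      (𝓝 (betaSeries κ (-r))) := by
  have hR : Tendsto (fun e : ℝ => ∑' j : ℕ,
      if j = r then 0 else binomCoeff κ j * ((j : ℝ) + (e - r))⁻¹) (𝓝[≠] 0)
      (𝓝 (∑' j : ℕ, if j = r then 0 else binomCoeff κ j * ((j : ℝ) + (0 - r))⁻¹)) := by
    refine tendsto_tsum_of_dominated_convergence ((summable_abs_binomCoeff hκ).mul_right 2)
      (fun j => ?_) ?_
    · refine tendsto_nhdsWithin_of_tendsto_nhds ?_
      split_ifs with hj
      · exact tendsto_const_nhds
      · have hj' : (j : ℝ) + (0 - r) ≠ 0 := by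
          rw [zero_sub, ← sub_eq_add_neg, sub_ne_zero]
          exact_mod_cast hj
        have : ContinuousAt (fun e : ℝ => binomCoeff κ j * ((j : ℝ) + (e - r))⁻¹) 0 :=
          continuousAt_const.mul (ContinuousAt.inv₀ (by fun_prop) hj')
        exact this.tendsto
    · have h1 : ∀ᶠ e : ℝ in 𝓝[≠] 0, |e| < 1 / 2 := by
        refine nhdsWithin_le_nhds ?_
        have := Metric.ball_mem_nhds (0 : ℝ) (by norm_num : (0 : ℝ) < 1 / 2)
        filter_upwards [this] with e he
        simpa using he
      filter_upwards [h1] with e he j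
      split_ifs with hj
      · simp
      · rw [norm_mul, Real.norm_eq_abs]
        refine mul_le_mul_of_nonneg_left ?_ (abs_nonneg _)
        have h2 : (1 : ℤ) ≤ |(j : ℤ) - r| := Int.one_le_abs (by omega)
        have h3 : (1 : ℝ) ≤ |(j : ℝ) - r| := by exact_mod_cast h2
        have h4 : |(j : ℝ) - r| ≤ |(j : ℝ) + (e - r)| + |e| := by
          rw [show (j : ℝ) - r = ((j : ℝ) + (e - r)) - e by ring]
          exact abs_sub _ _
        -- The bound 2 comes from |j-r| ≥ 1 and |e| < 1/2.
        rw [norm_inv, Real.norm_eq_abs]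
        rw [inv_le_comm₀ (by linarith) (by norm_num)]
        linarith
  have h0 : ∑' j : ℕ, (if j = r then 0 else binomCoeff κ j * ((j : ℝ) + (0 - r))⁻¹) =
      betaSeries κ (-r) := by
    refine tsum_congr fun j => ?_
    split_ifs with hj
    · simp [hj]
    · rw [zero_sub]
  rw [h0] at hR
  refine hR.congr fun e => ?_
  have hs := (summable_betaSeries hκ (e - r)).hasSum
  have hd := hasSum_ite_eq r (binomCoeff κ r * ((r : ℝ) + (e - r))⁻¹)
  have h := (hs.sub hd).tsum_eq
  rw [betaSeries, div_eq_mul_inv, show (e : ℝ)⁻¹ = ((r : ℝ) + (e - r))⁻¹ by congr 1; ring, ← h]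
  refine tsum_congr fun j => ?_
  split_ifs with hj
  · simp [hj]
  · simp

/-- Away from e = 0 the closed form minus its pole is a difference quotient of
Γ(1+e)Γ(1-e)/(Γ(1+r-e)Γ(1-(r-κ)+e)), up to a constant; its limit is the derivative at 0, in which
the two Γ'(1) cancel. -/
lemma betaSeries_neg_nat {κ : ℝ} (hκ : 0 < κ) (r : ℕ) :
    betaSeries κ (-r) = (-1) ^ r / (r.factorial : ℝ) * Real.Gamma (κ + 1) *
      (psi (r + 1) * rGamma (κ + 1 - r) + deriv rGamma (κ + 1 - r)) := by
  refine tendsto_nhds_unique (tendsto_betaSeries_punctured hκ r) ?_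
  have hG : HasDerivAt Real.Gamma (deriv Real.Gamma 1) 1 :=
    Real.hasDerivAt_Gamma_one.differentiableAt.hasDerivAt
  have h1 : HasDerivAt (fun e : ℝ => Real.Gamma (1 + e)) (deriv Real.Gamma 1) 0 :=
    HasDerivAt.comp_const_add 1 0 (by simpa using hG)
  have h2 : HasDerivAt (fun e : ℝ => Real.Gamma (1 - e)) (-deriv Real.Gamma 1) 0 :=
    HasDerivAt.comp_const_sub 1 0 (by simpa using hG)
  have h3 : HasDerivAt (fun e : ℝ => rGamma (1 + r - e)) (-deriv rGamma (1 + r)) 0 :=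
    HasDerivAt.comp_const_sub (1 + (r : ℝ)) 0 (by simpa using (differentiable_rGamma _).hasDerivAt)
  have h4 : HasDerivAt (fun e : ℝ => rGamma (κ + 1 - r + e)) (deriv rGamma (κ + 1 - r)) 0 :=
    HasDerivAt.comp_const_add (κ + 1 - r) 0 (by simpa using (differentiable_rGamma _).hasDerivAt)
  have h5 := ((((h1.mul h2).mul h3).mul h4).const_mul
    ((-1) ^ r * Real.Gamma (κ + 1))).tendsto_slope
  have hfac : rGamma (1 + r) = ((r.factorial : ℝ))⁻¹ := by
    rw [rGamma, add_comm, Real.Gamma_nat_eq_factorial]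
  have hpsi : -deriv rGamma (1 + r) = psi (r + 1) * ((r.factorial : ℝ))⁻¹ := by
    rw [deriv_rGamma (fun n => by
      have : (0 : ℝ) ≤ n := n.cast_nonneg
      have : (0 : ℝ) ≤ r := r.cast_nonneg
      linarith), hfac, add_comm]
    ring
  rw [hpsi] at h5
  have hlim : (-1) ^ r / (r.factorial : ℝ) * Real.Gamma (κ + 1) *
      (psi (r + 1) * rGamma (κ + 1 - r) + deriv rGamma (κ + 1 - r)) = (-1) ^ r * Real.Gamma (κ + 1) *
      ((((deriv Real.Gamma 1 * Real.Gamma (1 - 0) + Real.Gamma (1 + 0) * -deriv Real.Gamma 1) *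
        rGamma (1 + r - 0) + Real.Gamma (1 + 0) * Real.Gamma (1 - 0) *
        (psi (r + 1) * ((r.factorial : ℝ))⁻¹)) * rGamma (κ + 1 - r + 0) +
        Real.Gamma (1 + 0) * Real.Gamma (1 - 0) * rGamma (1 + r - 0) *
        deriv rGamma (κ + 1 - r))) := by
    simp only [sub_zero, add_zero, Real.Gamma_one, hfac]
    ring
  rw [hlim]
  refine h5.congr' ?_
  have hlt : ∀ᶠ e : ℝ in 𝓝[≠] 0, |e| < 1 := by
    refine nhdsWithin_le_nhds ?_
    filter_upwards [Metric.ball_mem_nhds (0 : ℝ) one_pos] with e he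
    simpa using he
  filter_upwards [hlt, self_mem_nhdsWithin] with e he he0
  have he0 : e ≠ 0 := he0
  have hne : ∀ n : ℕ, e - r ≠ -n := by
    intro n hn
    have h6 : e = ((r - n : ℤ) : ℝ) := by push_cast; linarith
    rw [h6] at he he0
    have h7 : |(r - n : ℤ)| < 1 := by exact_mod_cast he
    rw [Int.abs_lt_one_iff] at h7
    exact he0 (by rw [h7]; simp)
  have h8 := self_mul_Gamma_sub_nat (abs_pos.2 he0) he r
  rw [betaSeries_eq hκ hne, binomCoeff_eq_rGamma hκ]
  simp only [slope, Pi.mul_apply, vsub_eq_sub, smul_eq_mul, sub_zero, add_zero, Real.Gamma_one,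
    hfac]
  rw [show e - r + κ + 1 = κ + 1 - r + e by ring]
  field_simp
  linear_combination -rGamma (κ + 1 - r + e) * (r.factorial : ℝ) * h8

/-! ### Expansion of the integral and interchange of the sums. -/

-- Substitution t = u^{-1/2}; the indicators place (0,1) and (1,∞) inside the half-line where it
-- acts.
open MeasureTheory Set in
lemma integral_rpow_mul_exp_eq_expInt (N : ℕ) (x : ℝ) :
    ∫ u in (0 : ℝ)..1, u ^ ((N : ℝ) / 2 - 1) * Real.exp (-x * u ^ (-(1 / 2) : ℝ)) =
      2 * expInt N x := by
  have h := integral_comp_rpow_Ioi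
    ((Ioi (1 : ℝ)).indicator fun t : ℝ => (t ^ (N + 1))⁻¹ * Real.exp (-(x * t)))
    (p := (-(1 / 2) : ℝ)) (by norm_num)
  rw [setIntegral_indicator measurableSet_Ioi,
    inter_eq_self_of_subset_right (Ioi_subset_Ioi (zero_le_one' ℝ))] at h
  have e : ∫ u in Ioi (0 : ℝ), (|(-(1 / 2) : ℝ)| * u ^ ((-(1 / 2) : ℝ) - 1)) •
      (Ioi (1 : ℝ)).indicator (fun t : ℝ => (t ^ (N + 1))⁻¹ * Real.exp (-(x * t)))
        (u ^ (-(1 / 2) : ℝ)) =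
      ∫ u in Ioi (0 : ℝ), (Iio (1 : ℝ)).indicator (fun u : ℝ =>
        1 / 2 * (u ^ ((N : ℝ) / 2 - 1) * Real.exp (-x * u ^ (-(1 / 2) : ℝ)))) u := by
    refine setIntegral_congr_fun measurableSet_Ioi fun u hu => ?_
    have hu : 0 < u := hu
    by_cases h1 : u < 1
    · have h2 : u ^ (-(1 / 2) : ℝ) ∈ Ioi (1 : ℝ) :=
        Real.one_lt_rpow_of_pos_of_lt_one_of_neg hu h1 (by norm_num)
      simp only [indicator_of_mem h2, indicator_of_mem (show u ∈ Iio 1 from h1), smul_eq_mul]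
      rw [← Real.rpow_natCast, ← Real.rpow_mul hu.le, ← Real.rpow_neg hu.le, abs_neg,
        abs_of_pos (by norm_num : (0 : ℝ) < 1 / 2), mul_assoc, ← mul_assoc (u ^ _), ← Real.rpow_add hu,
        show (-(1 / 2) : ℝ) - 1 + -(-(1 / 2) * ((N + 1 : ℕ) : ℝ)) = N / 2 - 1 by push_cast; ring,
        neg_mul x]
    · have h2 : u ^ (-(1 / 2) : ℝ) ∉ Ioi (1 : ℝ) := by
        rw [mem_Ioi, not_lt]
        exact Real.rpow_le_one_of_one_le_of_nonpos (not_lt.1 h1) (by norm_num)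
      simp only [indicator_of_notMem h2, indicator_of_notMem (show u ∉ Iio 1 from h1), smul_zero]
  rw [e, setIntegral_indicator measurableSet_Iio, Ioi_inter_Iio, integral_const_mul] at h
  rw [intervalIntegral.integral_of_le zero_le_one, integral_Ioc_eq_integral_Ioo, expInt, ← h]
  ring

open MeasureTheory Set in
lemma hasSum_expInt (m : ℕ) {κ x : ℝ} (hκ : 0 < κ) (hx : 0 < x) :
    HasSum (fun j : ℕ => binomCoeff κ j * (2 * expInt (2 * (m + j) + 3) x))
      (∫ u in (0 : ℝ)..1, u ^ ((m : ℝ) + 1 / 2) * (1 - u) ^ κ *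
        Real.exp (-x * u ^ (-(1 / 2) : ℝ))) := by
  have h := intervalIntegral.hasSum_integral_of_dominated_convergence (a := 0) (b := 1)
    (μ := volume)
    (F := fun (j : ℕ) (u : ℝ) => binomCoeff κ j *
      (u ^ ((m : ℝ) + 1 / 2) * u ^ j * Real.exp (-x * u ^ (-(1 / 2) : ℝ))))
    (f := fun u => u ^ ((m : ℝ) + 1 / 2) * (1 - u) ^ κ * Real.exp (-x * u ^ (-(1 / 2) : ℝ)))
    (fun j _ => |binomCoeff κ j|)
    (fun k => Measurable.aestronglyMeasurable (by fun_prop))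
    (fun j => by
      refine ae_of_all _ fun u hu => ?_
      rw [uIoc_of_le zero_le_one] at hu
      have h0 : 0 ≤ u ^ ((m : ℝ) + 1 / 2) := Real.rpow_nonneg hu.1.le _
      have h1 : 0 ≤ u ^ j := pow_nonneg hu.1.le _
      have h2 : u ^ ((m : ℝ) + 1 / 2) ≤ 1 := Real.rpow_le_one hu.1.le hu.2 (by positivity)
      have h3 : Real.exp (-x * u ^ (-(1 / 2) : ℝ)) ≤ 1 := by
        rw [Real.exp_le_one_iff, neg_mul, neg_nonpos]
        exact mul_nonneg hx.le (Real.rpow_nonneg hu.1.le _)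
      rw [norm_mul, norm_mul, norm_mul, Real.norm_of_nonneg h0, Real.norm_of_nonneg h1,
        Real.norm_of_nonneg (Real.exp_pos _).le, Real.norm_eq_abs]
      refine mul_le_of_le_one_right (abs_nonneg _) ?_
      exact mul_le_one₀ (mul_le_one₀ h2 h1 (pow_le_one₀ hu.1.le hu.2)) (Real.exp_pos _).le h3)
    (ae_of_all _ fun t _ => summable_abs_binomCoeff hκ)
    intervalIntegrable_const
    (by
      filter_upwards [Measure.ae_ne volume (1 : ℝ)] with u hu1 hu
      rw [uIoc_of_le zero_le_one] at hu
      have h := (hasSum_binomCoeff κ hu.1.le (lt_of_le_of_ne hu.2 hu1)).mul_left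
        (u ^ ((m : ℝ) + 1 / 2) * Real.exp (-x * u ^ (-(1 / 2) : ℝ)))
      convert! h using 1
      · funext k
        ring
      · ring)
  convert! h using 1
  funext j
  rw [intervalIntegral.integral_const_mul, ← integral_rpow_mul_exp_eq_expInt]
  congr 1
  refine intervalIntegral.integral_congr_ae (ae_of_all _ fun u hu => ?_)
  rw [uIoc_of_le zero_le_one] at hu
  rw [← Real.rpow_natCast, ← Real.rpow_add hu.1]
  congr 2
  push_cast
  ring

/-- The terms obtained by summing the residual exponential series over the binomial index. -/
noncomputable def residueTerm (m : ℕ) (κ x : ℝ) (k : ℕ) : ℝ :=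
  -((-x) ^ k / (k.factorial : ℝ) * betaSeries κ ((2 * m + 3 - k) / 2))

/-- D is the sum of one absolutely convergent double series, read by rows and by columns. -/
lemma hasSum_residueTerm (m : ℕ) {κ : ℝ} (hκ : 0 < κ) (x : ℝ) :
    ∃ D : ℝ, HasSum (residueTerm m κ x) D ∧
      HasSum (fun j : ℕ => binomCoeff κ j * (2 * ∑' k : ℕ, (-x) ^ k / (k.factorial : ℝ) *
        ((k : ℝ) - (2 * (m + j) + 3 : ℕ))⁻¹)) D := by
  set f : ℕ × ℕ → ℝ := fun p => (-x) ^ p.1 / (p.1.factorial : ℝ) *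
    (binomCoeff κ p.2 * (2 * ((p.1 : ℝ) - (2 * (m + p.2) + 3 : ℕ))⁻¹)) with hf
  have hs : Summable f := by
    refine Summable.of_norm_bounded ((Real.summable_pow_div_factorial |x|).mul_of_nonneg
      ((summable_abs_binomCoeff hκ).mul_right 2) (fun _ => by positivity)
      (fun _ => by positivity)) fun p => ?_
    rw [hf]
    simp only [norm_mul, norm_div, norm_pow, norm_neg, Real.norm_eq_abs, abs_two, Nat.abs_cast]
    gcongr
    have := abs_inv_sub_nat_le_one p.1 (2 * (m + p.2) + 3)
    linarith
  refine ⟨∑' p, f p, ?_, ?_⟩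
  · have h := hs.hasSum.prod_fiberwise fun k => (hs.prod_factor k).hasSum
    convert! h using 1
    funext k
    simp only [hf]
    rw [residueTerm, tsum_mul_left, ← mul_neg]
    congr 1
    rw [betaSeries, ← tsum_neg]
    refine tsum_congr fun j => ?_
    rw [show ((2 * m + 3 - k) / 2 : ℝ) = -(((k : ℝ) - (2 * (m + j) + 3 : ℕ)) / 2) - j by
      push_cast; ring]
    rw [add_sub_cancel, inv_neg, inv_div]
    ring
  · have h := ((Equiv.prodComm ℕ ℕ).hasSum_iff.2 hs.hasSum).prod_fiberwise
      fun j => (((Equiv.prodComm ℕ ℕ).summable_iff.2 hs).prod_factor j).hasSum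
    convert! h using 1
    funext j
    rw [← tsum_mul_left, ← tsum_mul_left]
    refine tsum_congr fun k => ?_
    simp [hf]
    ring

/-- The logarithmic term of the exponential integral, weighted by the binomial coefficient. -/
noncomputable def logTerm (m : ℕ) (κ x : ℝ) (r : ℕ) : ℝ :=
  binomCoeff κ r * (2 * ((-x) ^ (2 * (m + r) + 3) / ((2 * (m + r) + 3).factorial : ℝ) *
    (-Real.log x + psi ((2 * (m + r) + 3 : ℕ) + 1))))

/-- The integral as a sum over even powers, low odd powers and high odd powers of `x`. -/
lemma integral_eq_residueTerm (m : ℕ) {κ x : ℝ} (hκ : 0 < κ) (hx : 0 < x) :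
    Summable (fun p => residueTerm m κ x (2 * p)) ∧
    Summable (fun r => logTerm m κ x r - residueTerm m κ x (2 * (m + r) + 3)) ∧
    (∫ u in (0 : ℝ)..1, u ^ ((m : ℝ) + 1 / 2) * (1 - u) ^ κ *
        Real.exp (-x * u ^ (-(1 / 2) : ℝ))) =
      -(∑' p, residueTerm m κ x (2 * p))
      - (∑ p ∈ Finset.range (m + 1), residueTerm m κ x (2 * p + 1))
      + ∑' r, (logTerm m κ x r - residueTerm m κ x (2 * (m + r) + 3)) := by
  obtain ⟨D, h1, h2⟩ := hasSum_residueTerm m hκ x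
  have h3 := hasSum_expInt m hκ hx
  have hL : HasSum (logTerm m κ x) ((∫ u in (0 : ℝ)..1, u ^ ((m : ℝ) + 1 / 2) * (1 - u) ^ κ *
        Real.exp (-x * u ^ (-(1 / 2) : ℝ))) + D) := by
    convert! h3.add h2 using 1
    funext j
    rw [expInt_eq hx, logTerm]
    ring
  have he : Summable (fun p => residueTerm m κ x (2 * p)) :=
    h1.summable.comp_injective (mul_right_injective₀ two_ne_zero)
  have ho : Summable (fun p => residueTerm m κ x (2 * p + 1)) :=
    h1.summable.comp_injective ((add_left_injective 1).comp (mul_right_injective₀ two_ne_zero))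
  have hidx : ∀ r : ℕ, 2 * (r + (m + 1)) + 1 = 2 * (m + r) + 3 := fun r => by ring
  have ho' : Summable (fun r => residueTerm m κ x (2 * (m + r) + 3)) := by
    have := (summable_nat_add_iff (m + 1)).2 ho
    simpa only [hidx] using this
  have hsplit := ho.sum_add_tsum_nat_add (m + 1)
  simp only [hidx] at hsplit
  have heo := tsum_even_add_odd he ho
  rw [h1.tsum_eq] at heo
  refine ⟨he, hL.summable.sub ho', ?_⟩
  rw [hL.summable.tsum_sub ho', hL.tsum_eq]
  linarith

/-! ### Identification of the coefficients. -/

lemma factorial_two_mul (p : ℕ) :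
    ((2 * p).factorial : ℝ) = 4 ^ p * (p.factorial : ℝ) * poch (1 / 2) p := by
  induction p with
  | zero => simp [poch_zero]
  | succ p ih =>
    rw [show 2 * (p + 1) = 2 * p + 1 + 1 by ring, Nat.factorial_succ, Nat.factorial_succ,
      Nat.factorial_succ p, poch_succ]
    push_cast
    rw [ih]
    ring

lemma factorial_two_mul_add_one (p : ℕ) :
    ((2 * p + 1).factorial : ℝ) = 4 ^ p * (p.factorial : ℝ) * poch (3 / 2) p := by
  induction p with
  | zero => simp [poch_zero]
  | succ p ih =>
    rw [show 2 * (p + 1) + 1 = 2 * p + 1 + 1 + 1 by ring, Nat.factorial_succ, Nat.factorial_succ,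
      Nat.factorial_succ p, poch_succ]
    push_cast at ih ⊢
    rw [ih]
    ring

/-- The coefficient of the logarithmic series in a form that makes sense for every `κ`. -/
noncomputable def logLimit (m : ℕ) (κ z : ℝ) (r : ℕ) : ℝ :=
  (-1) ^ (1 + m) * Real.Gamma (-m - 3 / 2 - r) / ((r.factorial : ℝ) * ((1 + m + r).factorial : ℝ)) *
    ((-Real.log z + psi (-m - 3 / 2 - r) + psi (1 + r) + psi (2 + m + r)) * rGamma (1 + κ - r) +
      deriv rGamma (1 + κ - r))

lemma logLimit_eq_logCoeff (m : ℕ) {κ : ℝ} (z : ℝ) {r : ℕ} (h : ∀ n : ℕ, 1 + κ - r ≠ -(n : ℝ)) :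
    logLimit m κ z r = logCoeff m κ z r := by
  have hs : (-1 : ℝ) ^ (1 + m + r) * (-1) ^ r = (-1) ^ (1 + m) := by
    rw [pow_add, mul_assoc, ← mul_pow]
    simp
  rw [logLimit, logCoeff, coeffG, coeffH, hs, deriv_rGamma h, rGamma]
  have := Real.Gamma_ne_zero h
  field_simp
  ring

lemma logLimit_of_pole (m : ℕ) {κ : ℝ} (z : ℝ) {r n : ℕ} (h : 1 + κ - r = -(n : ℝ)) :
    logLimit m κ z r = (-1) ^ (1 + m) * (-1) ^ n * (n.factorial : ℝ) * Real.Gamma (-m - 3 / 2 - r) /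
          ((r.factorial : ℝ) * ((1 + m + r).factorial : ℝ)) := by
  rw [logLimit, h, rGamma_neg_nat, deriv_rGamma_neg_nat]
  ring

lemma continuous_logLimit (m : ℕ) (z : ℝ) (r : ℕ) : Continuous fun κ => logLimit m κ z r := by
  have h1 := differentiable_rGamma.continuous
  have h2 := continuous_deriv_rGamma
  unfold logLimit
  fun_prop

lemma eventually_ne_neg_nat (y : ℝ) : ∀ᶠ x in 𝓝[≠] y, ∀ n : ℕ, x ≠ -(n : ℝ) := by
  have h1 : ∀ᶠ x in 𝓝[≠] y, x ∈ Metric.ball y (1 / 2) :=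
    nhdsWithin_le_nhds (Metric.ball_mem_nhds y (by norm_num))
  by_cases hy : ∃ n : ℕ, y = -(n : ℝ)
  · obtain ⟨k, rfl⟩ := hy
    filter_upwards [h1, self_mem_nhdsWithin] with x hx hxy n hn
    have hxy : x ≠ -(k : ℝ) := hxy
    rw [Metric.mem_ball, Real.dist_eq, hn] at hx
    have h2 : |((k - n : ℤ) : ℝ)| < 1 := by
      push_cast
      rw [show (k : ℝ) - n = -n - -k by ring]
      linarith
    have h3 : |(k - n : ℤ)| < 1 := by exact_mod_cast h2
    rw [Int.abs_lt_one_iff] at h3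
    have : k = n := by omega
    exact hxy (by rw [hn, this])
  · push Not at hy
    have h2 := (differentiable_rGamma.continuous.continuousAt (x := y)).eventually_ne
      (rGamma_ne_zero hy)
    filter_upwards [nhdsWithin_le_nhds h2] with x hx n hn
    exact hx (by rw [hn, rGamma_neg_nat])

/-- Off the isolated poles the coefficient agrees with a function continuous in κ. -/
lemma tendsto_logCoeff (m : ℕ) (κ z : ℝ) (r : ℕ) :
    Tendsto (fun k : ℝ => logCoeff m k z r) (𝓝[≠] κ) (𝓝 (logLimit m κ z r)) := by
  have h := (continuous_logLimit m z r).continuousAt (x := κ)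
  refine (tendsto_nhdsWithin_of_tendsto_nhds h.tendsto).congr' ?_
  have hmap : Tendsto (fun k : ℝ => 1 + k - r) (𝓝[≠] κ) (𝓝[≠] (1 + κ - r)) := by
    refine tendsto_nhdsWithin_iff.2 ⟨tendsto_nhdsWithin_of_tendsto_nhds
      (Continuous.tendsto (by fun_prop) κ), ?_⟩
    filter_upwards [self_mem_nhdsWithin] with k hk hk'
    have hk' : 1 + k - r = 1 + κ - r := hk'
    exact hk (show k = κ by linarith)
  filter_upwards [hmap.eventually (eventually_ne_neg_nat _)] with k hk
  exact logLimit_eq_logCoeff m z hk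

/-- With x = 2y the power 4^p cancels the one in (2p)! = 4^p p! (1/2)_p. -/
lemma neg_residueTerm_two_mul (m : ℕ) {κ y : ℝ} (hκ : 0 < κ) (p : ℕ) :
    -residueTerm m κ (2 * y) (2 * p) = Real.Gamma (κ + 1) / √Real.pi *
      (√Real.pi * Real.Gamma (m + 3 / 2) / Real.Gamma (m + 5 / 2 + κ) *
        oneFTwoTerm (-m - 3 / 2 - κ) (1 / 2) (-m - 1 / 2) (y ^ 2) p) := by
  have ha : ∀ n : ℕ, (m + 3 / 2 - p : ℝ) ≠ -n := by
    intro n h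
    have h' : ((2 * m + 3 + 2 * n : ℕ) : ℝ) = ((2 * p : ℕ) : ℝ) := by push_cast; linarith
    have := Nat.cast_injective h'
    omega
  have hpi : √Real.pi ≠ 0 := by positivity
  have h4 : ((-1) ^ p * (-1) ^ p : ℝ) = 1 := by rw [← mul_pow]; simp
  rw [residueTerm, neg_neg, show ((2 * m + 3 - (2 * p : ℕ)) / 2 : ℝ) = m + 3 / 2 - p by
    push_cast; ring, betaSeries_eq hκ ha,
    show (m + 3 / 2 - p + κ + 1 : ℝ) = m + 5 / 2 + κ - p by ring, rGamma_sub_nat, Gamma_sub_nat,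
    factorial_two_mul, oneFTwoTerm, rGamma]
  rw [show (1 - (m + 3 / 2) : ℝ) = -m - 1 / 2 by ring,
    show (1 - (m + 5 / 2 + κ) : ℝ) = -m - 3 / 2 - κ by ring, pow_mul,
    show (-(2 * y)) ^ 2 = 4 * y ^ 2 by ring, mul_pow]
  simp only [div_eq_mul_inv, mul_inv]
  have h5 : ((4 : ℝ) ^ p) * (4 ^ p)⁻¹ = 1 := mul_inv_cancel₀ (by positivity)
  have h6 := mul_inv_cancel₀ hpi
  linear_combination ((y ^ 2) ^ p * ((p.factorial : ℝ))⁻¹ * (poch (1 * 2⁻¹) p)⁻¹ *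
    Real.Gamma (m + 3 * 2⁻¹) * (poch (-m - 1 * 2⁻¹) p)⁻¹ * Real.Gamma (κ + 1) *
    poch (-m - 3 * 2⁻¹ - κ) p * (Real.Gamma (m + 5 * 2⁻¹ + κ))⁻¹) *
    ((4 : ℝ) ^ p * (4 ^ p)⁻¹ * h4 + h5 - h6)

lemma residueTerm_two_mul_add_one (m : ℕ) {κ y : ℝ} (hκ : 0 < κ) {p : ℕ} (hp : p ≤ m) :
    residueTerm m κ (2 * y) (2 * p + 1) = Real.Gamma (κ + 1) / √Real.pi *
      (2 * √Real.pi * Real.Gamma (1 + m) / Real.Gamma (2 + m + κ) * y *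
        ((1 / (p.factorial : ℝ)) * (poch (-1 - m - κ) p / (poch (3 / 2) p * poch (-m) p)) *
          (y ^ 2) ^ p)) := by
  have hpm : (p : ℝ) ≤ m := by exact_mod_cast hp
  have ha : ∀ n : ℕ, (1 + m - p : ℝ) ≠ -n := by
    intro n h
    have : (0 : ℝ) ≤ n := n.cast_nonneg
    linarith
  have hpi : √Real.pi ≠ 0 := by positivity
  have h4 : ((-1) ^ p * (-1) ^ p : ℝ) = 1 := by rw [← mul_pow]; simp
  rw [residueTerm, show ((2 * m + 3 - (2 * p + 1 : ℕ)) / 2 : ℝ) = 1 + m - p by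
    push_cast; ring, betaSeries_eq hκ ha,
    show (1 + m - p + κ + 1 : ℝ) = 2 + m + κ - p by ring, rGamma_sub_nat, Gamma_sub_nat,
    factorial_two_mul_add_one, rGamma]
  rw [show (1 - (1 + m) : ℝ) = -m by ring,
    show (1 - (2 + m + κ) : ℝ) = -1 - m - κ by ring, pow_succ, pow_mul,
    show (-(2 * y)) ^ 2 = 4 * y ^ 2 by ring, mul_pow]
  simp only [div_eq_mul_inv, mul_inv]
  have h5 : ((4 : ℝ) ^ p) * (4 ^ p)⁻¹ = 1 := mul_inv_cancel₀ (by positivity)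
  have h6 := mul_inv_cancel₀ hpi
  linear_combination ((y ^ 2) ^ p * ((p.factorial : ℝ))⁻¹ * (poch (3 * 2⁻¹) p)⁻¹ *
    Real.Gamma (1 + m) * (poch (-m) p)⁻¹ * Real.Gamma (κ + 1) * (2 * y) *
    poch (-1 - m - κ) p * (Real.Gamma (2 + m + κ))⁻¹) *
    ((4 : ℝ) ^ p * (4 ^ p)⁻¹ * h4 + h5 - h6)

lemma Gamma_neg_sub_half (q : ℕ) :
    Real.Gamma (-q - 1 / 2) = (-1) ^ (q + 1) * √Real.pi * (2 * 4 ^ q * (q.factorial : ℝ)) /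
      ((2 * q + 1).factorial : ℝ) := by
  have h1 := Gamma_sub_nat (1 / 2) (q + 1)
  have h2 := factorial_two_mul (q + 1)
  rw [show 2 * (q + 1) = 2 * q + 1 + 1 by ring, Nat.factorial_succ, Nat.factorial_succ q] at h2
  rw [show (-q - 1 / 2 : ℝ) = 1 / 2 - (q + 1 : ℕ) by push_cast; ring, h1, Real.Gamma_one_half_eq,
    show (1 - 1 / 2 : ℝ) = 1 / 2 by norm_num]
  have h0 : (((2 * q + 1).factorial : ℕ) : ℝ) ≠ 0 := by positivity
  have h3 : poch (1 / 2) (q + 1) ≠ 0 := by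
    intro h
    rw [h, mul_zero] at h2
    have : (((2 * q + 1 + 1) * (2 * q + 1).factorial : ℕ) : ℝ) ≠ 0 := by positivity
    exact this h2
  rw [div_eq_div_iff h3 h0]
  push_cast at h2
  have hq : (q : ℝ) + 1 ≠ 0 := by positivity
  apply mul_left_cancel₀ (mul_ne_zero two_ne_zero hq)
  linear_combination (-1) ^ (q + 1) * √Real.pi * h2

lemma logTerm_sub_residueTerm (m : ℕ) {κ y : ℝ} (hκ : 0 < κ) (hy : 0 < y) (r : ℕ) :
    logTerm m κ (2 * y) r - residueTerm m κ (2 * y) (2 * (m + r) + 3) =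
      Real.Gamma (κ + 1) / √Real.pi *
        (y ^ (2 * m + 3) * ((y ^ 2) ^ r * logLimit m κ (y ^ 2) r)) := by
  -- The gamma and psi arguments become -q-1/2, where duplication applies; 2 ln(2y) = 2 ln 2 + ln z
  -- absorbs its 2 ln 2.
  obtain ⟨q, hq⟩ : ∃ q, q = 1 + m + r := ⟨_, rfl⟩
  have hq' : (q : ℝ) = 1 + m + r := by rw [hq]; push_cast; ring
  have hpi : √Real.pi ≠ 0 := by positivity
  have hN : 2 * (m + r) + 3 = 2 * q + 1 := by omega
  have hf : (((2 * q + 1).factorial : ℕ) : ℝ) ≠ 0 := by positivity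
  rw [logTerm, residueTerm, logLimit, hN, ← hq,
    show ((2 * m + 3 - (2 * q + 1 : ℕ)) / 2 : ℝ) = -r by rw [hN.symm]; push_cast; ring,
    betaSeries_neg_nat hκ, binomCoeff_eq_rGamma hκ,
    show (-m - 3 / 2 - r : ℝ) = -q - 1 / 2 by rw [hq']; ring, Gamma_neg_sub_half, psi_neg_half,
    show (2 + m + r : ℝ) = q + 1 by rw [hq']; ring,
    show (((2 * q + 1 : ℕ) : ℝ) + 1) = 2 * q + 2 by push_cast; ring,
    Real.log_mul two_ne_zero hy.ne', Real.log_pow, add_comm (1 : ℝ) r, add_comm (1 : ℝ) κ]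
  have hpow : y ^ (2 * m + 3) * (y ^ 2) ^ r = y ^ (2 * q + 1) := by
    rw [← pow_mul, ← pow_add, hq]
    congr 1
    ring
  have hsign : (-1 : ℝ) ^ (1 + m) * (-1) ^ (q + 1) = -(-1) ^ r := by
    rw [hq, ← pow_add, show 1 + m + (1 + m + r + 1) = 2 * (m + 1) + (r + 1) by ring, pow_add,
      pow_mul]
    simp [pow_succ]
  have h2 : (-(2 * y)) ^ (2 * q + 1) = -(2 * 4 ^ q * y ^ (2 * q + 1)) := by
    rw [pow_succ, pow_mul, show (-(2 * y)) ^ 2 = 4 * y ^ 2 by ring, mul_pow, ← pow_mul y]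
    ring
  rw [← mul_assoc (y ^ (2 * m + 3)), hpow, h2]
  have hqf : (q.factorial : ℝ) ≠ 0 := by positivity
  have hrf : (r.factorial : ℝ) ≠ 0 := by positivity
  rw [show (-1 : ℝ) ^ (1 + m) * ((-1) ^ (q + 1) * √Real.pi * (2 * 4 ^ q * (q.factorial : ℝ)) /
      ((2 * q + 1).factorial : ℝ)) = ((-1) ^ (1 + m) * (-1) ^ (q + 1)) *
      (√Real.pi * (2 * 4 ^ q * (q.factorial : ℝ)) / ((2 * q + 1).factorial : ℝ)) by ring, hsign]
  field_simp
  push_cast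
  ring

/-! ### Integrability, rescaling and assembly. -/

lemma integrand_intervalIntegrable {β b ν κ d : ℝ} (hb : 0 < b) (hν : 0 ≤ ν) (hκ : 0 ≤ κ)
    (hβ : 0 < β) (hd : d = 1 / β) :
    IntervalIntegrable (fun x : ℝ => x ^ ν * (1 - β * x) ^ κ * Real.exp (-b * x ^ (-(1 / 2) : ℝ)))
      MeasureTheory.volume 0 d := by
  have hd0 : 0 < d := by rw [hd]; positivity
  refine (intervalIntegrable_const (c := d ^ ν)).mono_fun'
    (Measurable.aestronglyMeasurable (by fun_prop)) ?_
  refine (MeasureTheory.ae_restrict_iff' measurableSet_uIoc).2 (MeasureTheory.ae_of_all _ ?_)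
  intro x hx
  rw [Set.uIoc_of_le hd0.le] at hx
  have h1 : 0 ≤ 1 - β * x := by
    have : β * x ≤ β * d := mul_le_mul_of_nonneg_left hx.2 hβ.le
    rw [hd, mul_one_div_cancel hβ.ne'] at this
    linarith
  have h2 : 1 - β * x ≤ 1 := by
    have := mul_pos hβ hx.1
    linarith
  have h3 : Real.exp (-b * x ^ (-(1 / 2) : ℝ)) ≤ 1 := by
    rw [Real.exp_le_one_iff, neg_mul, neg_nonpos]
    exact mul_nonneg hb.le (Real.rpow_nonneg hx.1.le _)
  beta_reduce
  rw [norm_mul, norm_mul, Real.norm_of_nonneg (Real.rpow_nonneg hx.1.le _),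
    Real.norm_of_nonneg (Real.rpow_nonneg h1 _), Real.norm_of_nonneg (Real.exp_pos _).le, mul_assoc]
  have h4 : x ^ ν ≤ d ^ ν := Real.rpow_le_rpow hx.1.le hx.2 hν
  refine (mul_le_of_le_one_right (Real.rpow_nonneg hx.1.le _) ?_).trans h4
  exact mul_le_one₀ (Real.rpow_le_one h1 h2 hκ) (Real.exp_pos _).le h3

/-- Rescaling the integral to the unit interval. -/
lemma integral_rescale {β ν d : ℝ} (κ b : ℝ) (hβ : 0 < β) (hd : d = 1 / β) :
    ∫ x in (0 : ℝ)..d, x ^ ν * (1 - β * x) ^ κ * Real.exp (-b * x ^ (-(1 / 2) : ℝ)) =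
      (β ^ (ν + 1))⁻¹ * ∫ u in (0 : ℝ)..1, u ^ ν * (1 - u) ^ κ *
        Real.exp (-(b * √β) * u ^ (-(1 / 2) : ℝ)) := by
  have hsub := intervalIntegral.integral_comp_mul_left (a := 0) (b := d)
    (fun u : ℝ => u ^ ν * (1 - u) ^ κ * Real.exp (-(b * √β) * u ^ (-(1 / 2) : ℝ))) hβ.ne'
  rw [mul_zero, hd, mul_one_div_cancel hβ.ne', smul_eq_mul] at hsub
  rw [hd, Real.rpow_add_one hβ.ne', mul_inv, mul_assoc, ← hsub,
    ← intervalIntegral.integral_const_mul]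
  refine intervalIntegral.integral_congr_ae (MeasureTheory.ae_of_all _ fun x hx => ?_)
  rw [Set.uIoc_of_le (by positivity)] at hx
  have h1 : √β * β ^ (-(1 / 2) : ℝ) = 1 := by
    rw [Real.sqrt_eq_rpow, ← Real.rpow_add hβ]
    norm_num
  rw [Real.mul_rpow hβ.le hx.1.le, Real.mul_rpow hβ.le hx.1.le]
  have h2 : β ^ ν ≠ 0 := (Real.rpow_pos_of_pos hβ _).ne'
  rw [show -(b * √β) * (β ^ (-(1 / 2) : ℝ) * x ^ (-(1 / 2) : ℝ)) =
    -b * (√β * β ^ (-(1 / 2) : ℝ)) * x ^ (-(1 / 2) : ℝ) by ring, h1, mul_one]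
  field_simp

theorem mainTheorem9 (m : ℕ) (α b ν κ z d : ℝ) (hα : α < 1) (hb : 0 < b)
    (hν : ν = (m : ℝ) + 1 / 2) (hκ : κ = 1 / (1 - α)) (hz : z = (1 - α) * b ^ 2 / 4)
    (hd : d = 1 / (1 - α)) :
    IntervalIntegrable
      (fun x : ℝ => x ^ ν * (1 - (1 - α) * x) ^ (1 / (1 - α)) * Real.exp (-b * x ^ (-(1 / 2) : ℝ)))
      MeasureTheory.volume 0 d ∧
    Summable (oneFTwoTerm (-m - 3 / 2 - κ) (1 / 2) (-m - 1 / 2) z) ∧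
    ∃ c : ℕ → ℝ,
      (∀ r : ℕ, Tendsto (fun k : ℝ => logCoeff m k z r) (𝓝[≠] κ) (𝓝 (c r))) ∧
      (∀ r : ℕ, (∀ n : ℕ, 1 + κ - r ≠ -(n : ℝ)) → c r = logCoeff m κ z r) ∧
      (∀ r n : ℕ, 1 + κ - r = -(n : ℝ) →
        c r = (-1) ^ (1 + m) * (-1) ^ n * (n.factorial : ℝ) * Real.Gamma (-m - 3 / 2 - r) /
          ((r.factorial : ℝ) * ((1 + m + r).factorial : ℝ))) ∧
      Summable (fun r : ℕ => z ^ r * c r) ∧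
      (∫ x in (0 : ℝ)..d,
          x ^ ν * (1 - (1 - α) * x) ^ (1 / (1 - α)) * Real.exp (-b * x ^ (-(1 / 2) : ℝ))) =
        Real.Gamma (κ + 1) / (Real.sqrt Real.pi * (1 - α) ^ (ν + 1)) *
          (Real.sqrt Real.pi * Real.Gamma (m + 3 / 2) / Real.Gamma (m + 5 / 2 + κ) *
              oneFTwo (-m - 3 / 2 - κ) (1 / 2) (-m - 1 / 2) z
            - 2 * Real.sqrt Real.pi * Real.Gamma (1 + m) / Real.Gamma (2 + m + κ) *
              z ^ (1 / 2 : ℝ) * finitePart m κ z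
            + z ^ (m + 3 / 2 : ℝ) * ∑' r : ℕ, z ^ r * c r) := by
  have hβ : 0 < 1 - α := by linarith
  have hκ0 : 0 < κ := by rw [hκ]; positivity
  have hν0 : 0 ≤ ν := by rw [hν]; positivity
  -- Chosen so that 2y is the exponent parameter after rescaling and y = √z.
  set y : ℝ := b * √(1 - α) / 2 with hy_def
  have hy : 0 < y := by positivity
  have hzy : z = y ^ 2 := by
    rw [hz, hy_def, div_pow, mul_pow, Real.sq_sqrt hβ.le]
    ring
  have hzhalf : z ^ (1 / 2 : ℝ) = y := by
    rw [← Real.sqrt_eq_rpow, hzy, Real.sqrt_sq hy.le]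
  have hzm : z ^ (m + 3 / 2 : ℝ) = y ^ (2 * m + 3) := by
    rw [hzy, ← Real.rpow_natCast y 2, ← Real.rpow_mul hy.le, ← Real.rpow_natCast]
    congr 1
    push_cast
    ring
  have hΓ : 0 < Real.Gamma (κ + 1) := Real.Gamma_pos_of_pos (by linarith)
  have hC : Real.Gamma (κ + 1) / √Real.pi ≠ 0 := by positivity
  obtain ⟨hS1, hS2, hI⟩ := integral_eq_residueTerm m (x := 2 * y) hκ0 (by positivity)
  have he := fun p => neg_residueTerm_two_mul m (y := y) hκ0 p
  have hl := fun r => logTerm_sub_residueTerm m hκ0 hy r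
  simp only [hl] at hS2 hI
  have hS1' := hS1.neg
  simp only [he] at hS1'
  have hF : Real.Gamma (κ + 1) / √Real.pi * (√Real.pi * Real.Gamma (m + 3 / 2) /
      Real.Gamma (m + 5 / 2 + κ)) ≠ 0 := by
    have h1 : 0 < Real.Gamma (m + 3 / 2) := Real.Gamma_pos_of_pos (by positivity)
    have h2 : 0 < Real.Gamma (m + 5 / 2 + κ) := Real.Gamma_pos_of_pos (by positivity)
    positivity
  have hsum1 : Summable (oneFTwoTerm (-m - 3 / 2 - κ) (1 / 2) (-m - 1 / 2) z) := by
    simp only [← mul_assoc (Real.Gamma (κ + 1) / √Real.pi)] at hS1'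
    rw [hzy]
    exact (summable_mul_left_iff hF).1 hS1'
  have hsum2 : Summable (fun r : ℕ => z ^ r * logLimit m κ z r) := by
    rw [hzy]
    rw [summable_mul_left_iff hC, summable_mul_left_iff (by positivity)] at hS2
    exact hS2
  refine ⟨?_, hsum1, logLimit m κ z, tendsto_logCoeff m κ z,
    fun r h => logLimit_eq_logCoeff m z h, fun r n h => logLimit_of_pole m z h, hsum2, ?_⟩
  · exact integrand_intervalIntegrable hb hν0 (by rw [← hκ]; exact hκ0.le) hβ hd
  · rw [← hκ, integral_rescale κ b hβ hd, show b * √(1 - α) = 2 * y by rw [hy_def]; ring, hν, hI,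
      ← tsum_neg, tsum_congr he, tsum_mul_left, tsum_mul_left, tsum_mul_left, tsum_mul_left,
      Finset.sum_congr rfl fun p hp => residueTerm_two_mul_add_one m (y := y) hκ0
        (Nat.lt_succ_iff.1 (Finset.mem_range.1 hp)),
      ← Finset.mul_sum, ← Finset.mul_sum, hzhalf, hzm, hzy, oneFTwo, finitePart]
    simp only [div_eq_mul_inv, mul_inv]
    ring
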